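/- \textbf{Setting.} Let $x_{t+1}=f(x_t)+Bu_t+w_t$, $t\ge 0$, where $x_t,w_t\in\mathbb{R}^N$, $u_t\in\mathbb{R}^m$, $B:\mathbb{R}^m\to\mathbb{R}^N$ is linear, $(w_t)_{t\ge0}$ is an i.i.d. noise sequence independent of $x_0$, and $f:\mathbb{R}^N\to\mathbb{R}^N$ is continuously differentiable and invertible. Let $|J(f(x))|$ be the absolute value of the Jacobian determinant of $f$ at $x$, and suppose that $$M:=\sup_{x}\log_2|J(f(x))|<\infty,\qquad L:=\inf_{x}\log_2|J(f(x))|>-\infty$$ (in particular the determinant never vanishes). Suppose that the law of $x_0$ is absolutely continuous with respect to Lebesgue measure, with differential entropy $h(x_0)<\infty$. The system is controlled over a channel with finite input alphabet $\mathcal{M}$ and finite output alphabet $\mathcal{M}'$, given by conditional laws $P(q'_t\mid q_{[0,t]},q'_{[0,t-1]})$, $t\ge0$, with noiseless feedback. An admissible policy consists of measurable encoders $q_t=\gamma^e_t(x_{[0,t]},q'_{[0,t-1]})\in\mathcal{M}$ and controllers $u_t=\gamma_t(q'_{[0,t]})$, $t\ge 0$. The channel is of Class A with feedback capacity $C$: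 for every $t\ge0$, almost surely for every set $S\subseteq\mathcal{M}'$, $$P(q'_t\in S\mid q_{[0,t]},q'_{[0,t-1]},x_0,(w_s)_{s\ge0})=P(q'_t\in S\mid q_{[0,t]},q'_{[0,t-1]}),$$ and the following limit exists and equals $C$: $$C=\lim_{T\to\infty}\ \max_{\{P(q_t\mid q_{[0,t-1]},q'_{[0,t-1]}),\ 0\le t\le T-1\}}\ \frac1T\sum_{t=0}^{T-1}I\big(q_{[0,t]};q'_t\mid q'_{[0,t-1]}\big),$$ where the maximum is over all families of channel input kernels, mutual information is in bits, and the term for $t=0$ is $I(q_0;q'_0)$. \textbf{Theorem.} If $C<L$, then under any admissible policy $$\limsup_{T\to\infty}P\big(|x_T|\le b(T)\big)\le 1-\frac{L-C}{M}$$ for every $b:\mathbb{N}\to(0,\infty)$ such that $\lim_{T\to\infty}\frac1T\log_2 b(T)=0$, where $|\cdot|$ is the Euclidean norm. -/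

import Mathlib

open MeasureTheory ProbabilityTheory Filter Topology

noncomputable section

namespace NetCtrl

/-! ## Discrete information measures, in bits -/

/-- Probability of the event `X = a` when the sample point has law `p`. -/
def prob {Ω α : Type*} (p : PMF Ω) (X : Ω → α) (a : α) : ℝ :=
  (p.map X a).toReal

/-- Conditional entropy
`H(Y | Z) = ∑ z, P(Z = z) · (-∑ y, P(Y = y | Z = z) log₂ P(Y = y | Z = z))`. -/
def condEntropy {Ω α β : Type*} [Fintype α] [Fintype β]
    (p : PMF Ω) (Y : Ω → α) (Z : Ω → β) : ℝ :=
  ∑ z, prob p Z z *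
    (-∑ y, ((prob p (fun ω => (Y ω, Z ω)) (y, z) / prob p Z z) *
      Real.logb 2 (prob p (fun ω => (Y ω, Z ω)) (y, z) / prob p Z z)))

/-- Conditional mutual information `I(X ; Y | Z) = H(Y | Z) - H(Y | X, Z)`. -/
def condMutualInfo {Ω α β γ : Type*} [Fintype α] [Fintype β] [Fintype γ]
    (p : PMF Ω) (X : Ω → α) (Y : Ω → β) (Z : Ω → γ) : ℝ :=
  condEntropy p Y Z - condEntropy p Y (fun ω => (X ω, Z ω))

/-! ## Channels with feedback -/

/-- A finite-alphabet channel with memory: `W t q_{[0,t]} q'_{[0,t-1]}` is the conditional law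
of the channel output `q'_t`. -/
abbrev Channel (A A' : Type*) : Type _ :=
  (t : ℕ) → (Fin (t + 1) → A) → (Fin t → A') → PMF A'

/-- A family of channel input kernels `P(q_t | q_{[0,t-1]}, q'_{[0,t-1]})`, `t ≥ 0`. -/
abbrev InputKernels (A A' : Type*) : Type _ :=
  (t : ℕ) → (Fin t → A) → (Fin t → A') → PMF A

/-- The joint law of `(q_{[0,T-1]}, q'_{[0,T-1]})` induced by input kernels `π` and a
channel `W`. -/
def jointLaw {A A' : Type*} (W : Channel A A') (π : InputKernels A A') :
    (T : ℕ) → PMF ((Fin T → A) × (Fin T → A'))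
  | 0 => PMF.pure (Fin.elim0, Fin.elim0)
  | T + 1 =>
      (jointLaw W π T).bind fun h =>
        (π T h.1 h.2).bind fun a =>
          (W T (Fin.snoc (α := fun _ => A) h.1 a) h.2).map fun b =>
            (Fin.snoc (α := fun _ => A) h.1 a, Fin.snoc (α := fun _ => A') h.2 b)

/-- The directed information
`I(q_{[0,T-1]} → q'_{[0,T-1]}) = ∑_{t=0}^{T-1} I(q_{[0,t]} ; q'_t | q'_{[0,t-1]})`
of a law on pairs of input and output strings of length `T`. For `t = 0` the conditioning
variable is constant, so that the term is `I(q_0 ; q'_0)`. -/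
def directedInfo {A A' : Type*} [Fintype A] [Fintype A'] {T : ℕ}
    (p : PMF ((Fin T → A) × (Fin T → A'))) : ℝ :=
  ∑ t : Fin T, condMutualInfo p
    (fun h (i : Fin (t + 1)) => h.1 (Fin.castLE t.isLt i))
    (fun h => h.2 t)
    (fun h (i : Fin t) => h.2 (Fin.castLE t.isLt.le i))

/-- `max (1/T) I(q_{[0,T-1]} → q'_{[0,T-1]})` over all input kernels with feedback.
(Directed information is at most `T log₂ |A'|`, so this is a supremum of a bounded set.) -/
def maxDirectedInfoRate {A A' : Type*} [Fintype A] [Fintype A'] (W : Channel A A') (T : ℕ) : ℝ :=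
  ⨆ π : InputKernels A A', (1 / (T : ℝ)) * directedInfo (jointLaw W π T)

/-! ## The control loop -/

/-- The state space `ℝ^N` with the Euclidean norm. -/
abbrev Vec (N : ℕ) : Type := EuclideanSpace ℝ (Fin N)

/-- The initial segment `X_{[0,n-1]}` of a sequence of random variables. -/
def hist {Ω α : Type*} (X : ℕ → Ω → α) (n : ℕ) (ω : Ω) : Fin n → α := fun i => X i ω

/-- The σ-algebra generated by `q_{[0,t]}` and `q'_{[0,t-1]}`. -/
abbrev channelPast {Ω A A' : Type*} [MeasurableSpace A] [MeasurableSpace A']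
    (q : ℕ → Ω → A) (q' : ℕ → Ω → A') (t : ℕ) : MeasurableSpace Ω :=
  MeasurableSpace.comap (hist q (t + 1)) inferInstance ⊔
    MeasurableSpace.comap (hist q' t) inferInstance

/-- The σ-algebra generated by `x_0` and the whole noise sequence `w_s`, `s ≥ 0`. -/
abbrev sourceSigma {Ω : Type*} {N : ℕ} (x₀ : Ω → Vec N) (w : ℕ → Ω → Vec N) : MeasurableSpace Ω :=
  MeasurableSpace.comap x₀ inferInstance ⊔
    MeasurableSpace.comap (fun ω s => w s ω) inferInstance

/-- `log₂ |J(f(x))|`, the logarithm of the absolute value of the Jacobian determinant. It is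
only used together with the requirement that the determinant does not vanish. -/
def logJac {N : ℕ} (f : Vec N → Vec N) (x : Vec N) : ℝ :=
  Real.logb 2 |(fderiv ℝ f x).det|

/-- `L = inf_x log₂|J(f(x))| > -∞` and `M = sup_x log₂|J(f(x))| < ∞`. Since `log₂ 0 = -∞`,
the first part contains that the Jacobian determinant vanishes nowhere. -/
structure LogJacBounds {N : ℕ} (f : Vec N → Vec N) (L M : ℝ) : Prop where
  det_ne_zero : ∀ x, (fderiv ℝ f x).det ≠ 0
  isGLB : IsGLB (Set.range (logJac f)) L
  isLUB : IsLUB (Set.range (logJac f)) M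

/-- Differential entropy `h = -∫ p log₂ p dx` in bits, with values in `[-∞, ∞]`, of an absolutely
continuous law with density `p = dρ/dx`. The integral is the difference of the integrals of the
positive and negative parts of `p log₂ p`; in `EReal`, `⊤ - ⊤ = ⊥`, so this is `< ⊤` exactly when
the negative part of `p log₂ p` is integrable. -/
def diffEntropy {N : ℕ} (ρ : Measure (Vec N)) : EReal :=
  -(((∫⁻ x, ENNReal.ofReal ((ρ.rnDeriv volume x).toReal *
        Real.logb 2 (ρ.rnDeriv volume x).toReal) : ENNReal) : EReal) -
    ((∫⁻ x, ENNReal.ofReal (-((ρ.rnDeriv volume x).toReal *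
        Real.logb 2 (ρ.rnDeriv volume x).toReal)) : ENNReal) : EReal))

/-- The closed loop formed by the system `x_{t+1} = f(x_t) + B u_t + w_t`, the channel `W`, the
encoders `γe t` and the controllers `γc t`. -/
structure IsClosedLoop {Ω A A' : Type*} [MeasurableSpace Ω]
    [MeasurableSpace A] [MeasurableSpace A'] {N m : ℕ}
    (P : Measure Ω) (f : Vec N → Vec N) (B : Vec m →ₗ[ℝ] Vec N) (ν : Measure (Vec N))
    (W : Channel A A')
    (γe : (t : ℕ) → (Fin (t + 1) → Vec N) → (Fin t → A') → A)
    (γc : (t : ℕ) → (Fin (t + 1) → A') → Vec m)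
    (x w : ℕ → Ω → Vec N) (u : ℕ → Ω → Vec m) (q : ℕ → Ω → A) (q' : ℕ → Ω → A') : Prop where
  measurable_init : Measurable (x 0)
  measurable_noise : ∀ t, Measurable (w t)
  measurable_output : ∀ t, Measurable (q' t)
  measurable_encoder : ∀ t, Measurable (Function.uncurry (γe t))
  /-- The noise is i.i.d. with law `ν` and independent of the initial state. -/
  noise_indep : iIndepFun w P
  noise_law : ∀ t, P.map (w t) = ν
  init_indep : IndepFun (x 0) (fun ω s => w s ω) P
  /-- `x_{t+1} = f(x_t) + B u_t + w_t`. -/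
  state_eq : ∀ t ω, x (t + 1) ω = f (x t ω) + B (u t ω) + w t ω
  /-- `q_t = γe_t(x_{[0,t]}, q'_{[0,t-1]})`. -/
  encoder_eq : ∀ t ω, q t ω = γe t (hist x (t + 1) ω) (hist q' t ω)
  /-- `u_t = γc_t(q'_{[0,t]})`. -/
  control_eq : ∀ t ω, u t ω = γc t (hist q' (t + 1) ω)
  /-- `P(q'_t = b | q_{[0,t]}, q'_{[0,t-1]})` is given by the channel. -/
  channel_law : ∀ t (b : A'), P⟦q' t ⁻¹' {b} | channelPast q q' t⟧ =ᵐ[P]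
    fun ω => (W t (hist q (t + 1) ω) (hist q' t ω) b).toReal

/-- The channel `W`, used in a loop with initial state `x₀`, noise `w`, inputs `q` and outputs
`q'`, is of Class A with feedback capacity `C`. -/
structure IsClassA {Ω A A' : Type*} [MeasurableSpace Ω] [Fintype A] [Fintype A']
    [MeasurableSpace A] [MeasurableSpace A'] {N : ℕ}
    (P : Measure Ω) (W : Channel A A') (x₀ : Ω → Vec N) (w : ℕ → Ω → Vec N)
    (q : ℕ → Ω → A) (q' : ℕ → Ω → A') (C : ℝ) : Prop where
  /-- `q'_t ↔ q_{[0,t]}, q'_{[0,t-1]} ↔ {x_0, w_s, s ≥ 0}` is a Markov chain. -/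
  markov : ∀ t (S : Set A'),
    P⟦q' t ⁻¹' S | channelPast q q' t ⊔ sourceSigma x₀ w⟧ =ᵐ[P] P⟦q' t ⁻¹' S | channelPast q q' t⟧
  /-- `C = lim_T max (1/T) I(q_{[0,T-1]} → q'_{[0,T-1]})`; the limit exists. -/
  capacity : Tendsto (maxDirectedInfoRate W) atTop (𝓝 C)

end NetCtrl

end

/-! Freeze the channel outputs. The controls become constants and each step is `f` followed by a
translation, so `x 0 ↦ x T` expands volume at least by `2 ^ (L * T)`
(`pow_mul_volume_openLoopState_le`). Outside an event of probability at most η the law of `x 0` has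
bounded density, so a fixed output string brings the state into the ball of radius `b T` with
probability at most ε, where ε is `2 ^ (-L * T)` up to subexponential factors
(`measure_openLoopState_le`).

In closed loop the outputs depend on the source (initial state and noise), and directed information
limits what this can gain. Compare with a reference law under which outputs and source are
independent with their closed-loop marginals. Its density is, up to an inequality that suffices,
P(outputs) / `likelihood`; the Class A property is what allows this
(`setLIntegral_div_likelihood_le`). Directed information is the expected logarithm of the inverse of
this ratio (`directedInfo_mul_log_two`). Applying log y ≤ y - 1 to the ratio, multiplied by ε⁻¹ on
the success event, gives P(success) · log ε⁻¹ ≤ I · log 2 + 1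
(`measureReal_mul_log_le_directedInfo`).

Dividing by T and letting T → ∞, then η → 0, bounds the limsup by C / L = 1 - (L - C) / L. This is
at most 1 - (L - C) / M, since C < L ≤ M and L > C ≥ 0. -/

noncomputable section

namespace NetCtrl

/-! ### Discrete entropies: crude bounds and expectation formulas -/

section Finite

variable {Ω α β γ : Type*}

theorem integral_comp_fintype [Fintype α] [MeasurableSpace Ω] (P : Measure Ω) [IsFiniteMeasure P]
    (V : Ω → α) (hV : ∀ v, MeasurableSet (V ⁻¹' {v})) (F : α → ℝ) :
    ∫ ω, F (V ω) ∂P = ∑ v, P.real (V ⁻¹' {v}) * F v := by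
  let _ : MeasurableSpace α := ⊤
  have hm : Measurable V := measurable_to_countable' hV
  have := integral_map (μ := P) hm.aemeasurable (f := F)
    (Measurable.of_discrete (f := F)).aestronglyMeasurable
  rw [← this, integral_fintype (Integrable.of_finite)]
  refine Finset.sum_congr rfl fun v _ => ?_
  rw [smul_eq_mul, map_measureReal_apply hm (measurableSet_singleton v)]

theorem prob_nonneg (p : PMF Ω) (X : Ω → γ) (a : γ) : 0 ≤ prob p X a := ENNReal.toReal_nonneg

theorem prob_le_one (p : PMF Ω) (X : Ω → γ) (a : γ) : prob p X a ≤ 1 :=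
  ENNReal.toReal_le_of_le_ofReal zero_le_one 
    (by rw [ENNReal.ofReal_one]; exact PMF.coe_le_one _ _)

theorem prob_eq_toOuterMeasure (p : PMF Ω) (X : Ω → γ) (a : γ) :
    prob p X a = (p.toOuterMeasure (X ⁻¹' {a})).toReal := by
  rw [prob, ← PMF.toOuterMeasure_map_apply, PMF.toOuterMeasure_apply_singleton]

theorem prob_pair_le (p : PMF Ω) (Y : Ω → α) (Z : Ω → γ) (y : α) (z : γ) :
    prob p (fun ω => (Y ω, Z ω)) (y, z) ≤ prob p Z z := by
  rw [prob_eq_toOuterMeasure, prob_eq_toOuterMeasure]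
  refine ENNReal.toReal_mono ?_ (p.toOuterMeasure.mono ?_)
  · rw [← PMF.toOuterMeasure_map_apply, PMF.toOuterMeasure_apply_singleton]
    exact PMF.apply_ne_top _ _
  · intro ω hω
    simp only [Set.mem_preimage, Set.mem_singleton_iff, Prod.mk.injEq] at hω ⊢
    exact hω.2

theorem prob_eq_measureReal [MeasurableSpace Ω] (P : Measure Ω)
    {Ω' : Type*} [Countable Ω'] (p : PMF Ω') (H : Ω → Ω') (hH : ∀ v, MeasurableSet (H ⁻¹' {v}))
    (hp : ∀ v, p v = P (H ⁻¹' {v})) (X : Ω' → γ) (a : γ) :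
    prob p X a = P.real {ω | X (H ω) = a} := by
  let _ : MeasurableSpace Ω' := ⊤
  have hHm : Measurable H := measurable_to_countable' hH
  have hm : p.toMeasure = P.map H := by
    refine Measure.ext_of_singleton fun v => ?_
    rw [PMF.toMeasure_apply_singleton _ _ (measurableSet_singleton v), hp,
      Measure.map_apply hHm (measurableSet_singleton v)]
  rw [prob_eq_toOuterMeasure, ← PMF.toMeasure_apply_eq_toOuterMeasure, hm,
    Measure.map_apply hHm (MeasurableSet.of_discrete), measureReal_def]
  rfl

variable [Fintype α] [Fintype β]

theorem condEntropy_nonneg (p : PMF Ω) (Y : Ω → α) (Z : Ω → β) : 0 ≤ condEntropy p Y Z := by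
  refine Finset.sum_nonneg fun z _ => mul_nonneg (prob_nonneg _ _ _) ?_
  rw [neg_nonneg]
  refine Finset.sum_nonpos fun y _ => ?_
  have h0 := div_nonneg (prob_nonneg p (fun ω => (Y ω, Z ω)) (y, z)) (prob_nonneg p Z z)
  exact mul_nonpos_of_nonneg_of_nonpos h0 (Real.logb_nonpos one_lt_two h0
    (div_le_one_of_le₀ (prob_pair_le _ _ _ _ _) (prob_nonneg _ _ _)))

theorem neg_mul_logb_two_le {x : ℝ} (hx : 0 ≤ x) : -(x * Real.logb 2 x) ≤ 1 / Real.log 2 := by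
  rw [Real.logb, ← mul_div_assoc, ← neg_div]
  refine div_le_div_of_nonneg_right ?_ (Real.log_nonneg one_le_two)
  have := Real.negMulLog_le_one_sub_self hx
  rw [Real.negMulLog] at this
  linarith

theorem condEntropy_le (p : PMF Ω) (Y : Ω → α) (Z : Ω → β) :
    condEntropy p Y Z ≤ Fintype.card β * (Fintype.card α * (1 / Real.log 2)) := by
  rw [condEntropy, ← nsmul_eq_mul, ← Finset.card_univ]
  refine Finset.sum_le_card_nsmul _ _ _ fun z _ => ?_
  have h0 : ∀ y, 0 ≤ prob p (fun ω => (Y ω, Z ω)) (y, z) / prob p Z z := fun y =>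
    div_nonneg (prob_nonneg _ _ _) (prob_nonneg _ _ _)
  have hB : (-∑ y, ((prob p (fun ω => (Y ω, Z ω)) (y, z) / prob p Z z) *
      Real.logb 2 (prob p (fun ω => (Y ω, Z ω)) (y, z) / prob p Z z))) ≤
      Fintype.card α * (1 / Real.log 2) := by
    rw [← Finset.sum_neg_distrib, ← nsmul_eq_mul, ← Finset.card_univ]
    exact Finset.sum_le_card_nsmul _ _ _ fun y _ => neg_mul_logb_two_le (h0 y)
  refine (mul_le_mul_of_nonneg_left hB (prob_nonneg _ _ _)).trans
    (mul_le_of_le_one_left (by have := Real.log_pos one_lt_two; positivity) (prob_le_one _ _ _))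

/-- If `p` is the law of `H`, conditional entropies under `p` are expected log-likelihoods. -/
theorem condEntropy_eq_integral [MeasurableSpace Ω] (P : Measure Ω) [IsProbabilityMeasure P]
    {Ω' : Type*} [Countable Ω'] (p : PMF Ω') (H : Ω → Ω') (hH : ∀ v, MeasurableSet (H ⁻¹' {v}))
    (hp : ∀ v, p v = P (H ⁻¹' {v})) (Y : Ω' → α) (Z : Ω' → β) :
    condEntropy p Y Z = -∫ ω, Real.logb 2
      (P.real {ω' | Y (H ω') = Y (H ω) ∧ Z (H ω') = Z (H ω)} /
        P.real {ω' | Z (H ω') = Z (H ω)}) ∂P := by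
  let _ : MeasurableSpace Ω' := ⊤
  have hHm : Measurable H := measurable_to_countable' hH
  have hI := integral_comp_fintype P (fun ω => (Y (H ω), Z (H ω)))
    (fun v => hHm (MeasurableSet.of_discrete (s := {h | (Y h, Z h) = v})))
    (fun v => Real.logb 2 (P.real {ω' | Y (H ω') = v.1 ∧ Z (H ω') = v.2} /
        P.real {ω' | Z (H ω') = v.2}))
  simp only at hI
  rw [hI, condEntropy, Fintype.sum_prod_type_right, ← Finset.sum_neg_distrib]
  refine Finset.sum_congr rfl fun z _ => ?_
  rw [mul_neg, Finset.mul_sum]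
  congr 1
  refine Finset.sum_congr rfl fun y _ => ?_
  rw [prob_eq_measureReal P p H hH hp Z z, prob_eq_measureReal P p H hH hp (fun ω => (Y ω, Z ω)) (y, z)]
  have hset : (fun ω => (Y (H ω), Z (H ω))) ⁻¹' {(y, z)} = {ω' | Y (H ω') = y ∧ Z (H ω') = z} := by
    ext; simp
  simp only [Prod.mk.injEq, hset]
  -- On a null conditioning event both sides vanish, whatever value the quotient takes there.
  rcases eq_or_ne (P.real {ω | Z (H ω) = z}) 0 with h0 | h0
  · have : P.real {ω' | Y (H ω') = y ∧ Z (H ω') = z} = 0 :=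
      le_antisymm (h0 ▸ measureReal_mono fun ω h => h.2) measureReal_nonneg
    rw [h0, this]; simp
  · rw [← mul_assoc, mul_div_cancel₀ _ h0]

end Finite

/-- A real `⨆` dominates its terms only when the family is bounded. Any bound uniform in the input
kernels will do, so the crude estimate -x log x ≤ 1 is summed over all values. -/
theorem bddAbove_directedInfoRate {A A' : Type*} [Fintype A] [Fintype A'] (W : Channel A A')
    (T : ℕ) : BddAbove (Set.range fun π : InputKernels A A' =>
      (1 / (T : ℝ)) * directedInfo (jointLaw W π T)) := by
  refine ⟨1 / (T : ℝ) * ∑ t : Fin T,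
    (Fintype.card (Fin t → A') * (Fintype.card A' * (1 / Real.log 2)) : ℝ), ?_⟩
  rintro _ ⟨π, rfl⟩
  refine mul_le_mul_of_nonneg_left (Finset.sum_le_sum fun t _ => ?_) (by positivity)
  rw [condMutualInfo]
  have h1 := condEntropy_le (jointLaw W π T) (fun h => h.2 t)
    (fun h (i : Fin t) => h.2 (Fin.castLE t.isLt.le i))
  have h2 := condEntropy_nonneg (jointLaw W π T) (fun h => h.2 t) (fun h =>
    ((fun h (i : Fin (t + 1)) => h.1 (Fin.castLE t.isLt i)) h,
      (fun h (i : Fin t) => h.2 (Fin.castLE t.isLt.le i)) h))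
  linarith

/-! ### Volume expansion along open-loop trajectories -/

section OpenLoop

variable {A' : Type*} {N m : ℕ}

/-- The state at time `t` as a function of the initial state and the noise, when the channel
outputs are `s`. -/
def openLoopState (f : Vec N → Vec N) (B : Vec m →ₗ[ℝ] Vec N)
    (γc : (t : ℕ) → (Fin (t + 1) → A') → Vec m) (s : ℕ → A') :
    ℕ → Vec N × (ℕ → Vec N) → Vec N
  | 0, S => S.1
  | t + 1, S => f (openLoopState f B γc s t S) + B (γc t fun i => s i) + S.2 t

variable {f : Vec N → Vec N} {B : Vec m →ₗ[ℝ] Vec N}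
  {γc : (t : ℕ) → (Fin (t + 1) → A') → Vec m} {s : ℕ → A'}

theorem measurable_openLoopState (hf : Measurable f) (t : ℕ) :
    Measurable (openLoopState f B γc s t) := by
  induction t with
  | zero => exact measurable_fst
  | succ t ih =>
    exact ((hf.comp ih).add_const _).add ((measurable_pi_apply t).comp measurable_snd)

/-- A map with `|det Df| ≥ c` expands volumes by the factor `c`. -/
theorem mul_volume_preimage_le {c : ENNReal} (hf : ContDiff ℝ 1 f) (hinj : Function.Injective f)
    (hc : ∀ x, c ≤ ENNReal.ofReal |(fderiv ℝ f x).det|) {D : Set (Vec N)} (hD : MeasurableSet D) :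
    c * volume (f ⁻¹' D) ≤ volume D := by
  have hD' : MeasurableSet (f ⁻¹' D) := hf.continuous.measurable hD
  calc c * volume (f ⁻¹' D) = ∫⁻ _ in f ⁻¹' D, c := by rw [setLIntegral_const]
    _ ≤ ∫⁻ x in f ⁻¹' D, ENNReal.ofReal |(fderiv ℝ f x).det| := lintegral_mono hc
    _ = volume (f '' (f ⁻¹' D)) := lintegral_abs_det_fderiv_eq_addHaar_image volume hD'
        (fun x _ => ((hf.differentiable one_ne_zero) x).hasFDerivAt.hasFDerivWithinAt)
        hinj.injOn
    _ ≤ volume D := measure_mono (Set.image_preimage_subset _ _)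

/-- With outputs and noise fixed, each step is `f`, which expands volume by at least `c`, followed
by a translation, which preserves it. The induction peels off the last step by replacing `D` with
its preimage. -/
theorem pow_mul_volume_openLoopState_le {c : ENNReal} (hf : ContDiff ℝ 1 f)
    (hinj : Function.Injective f) (hc : ∀ x, c ≤ ENNReal.ofReal |(fderiv ℝ f x).det|)
    (v : ℕ → Vec N) (t : ℕ) {D : Set (Vec N)} (hD : MeasurableSet D) :
    c ^ t * volume {y | openLoopState f B γc s t (y, v) ∈ D} ≤ volume D := by
  induction t generalizing D with
  | zero => simp [openLoopState]
  | succ t ih =>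
    set d := B (γc t fun i => s i) + v t
    have hD' : MeasurableSet ((fun y => y + d) ⁻¹' D) := (measurable_add_const d) hD
    have h1 := ih (hf.continuous.measurable hD')
    have h2 := mul_volume_preimage_le hf hinj hc hD'
    rw [measure_preimage_add_right] at h2
    calc c ^ (t + 1) * volume {y | openLoopState f B γc s (t + 1) (y, v) ∈ D}
        = c * (c ^ t * volume {y | openLoopState f B γc s t (y, v) ∈
            f ⁻¹' ((fun y => y + d) ⁻¹' D)}) := by
          rw [pow_succ', mul_assoc]; simp [openLoopState, d, add_assoc]
      _ ≤ c * volume (f ⁻¹' ((fun y => y + d) ⁻¹' D)) := by gcongr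
      _ ≤ volume D := h2

/-- With bounded initial density on `G` and independent noise, the probability that an open-loop
trajectory started in `G` ends in a given ball. -/
theorem measure_openLoopState_le {Ω : Type*} [MeasurableSpace Ω] {P : Measure Ω}
    [IsProbabilityMeasure P] {x₀ : Ω → Vec N} {w : ℕ → Ω → Vec N} (hx₀ : Measurable x₀)
    (hw : ∀ t, Measurable (w t)) (hind : IndepFun x₀ (fun ω s => w s ω) P) {c K : ENNReal}
    (hf : ContDiff ℝ 1 f) (hinj : Function.Injective f) (hc0 : c ≠ 0) (hct : c ≠ ⊤)
    (hc : ∀ x, c ≤ ENNReal.ofReal |(fderiv ℝ f x).det|) {G : Set (Vec N)} (hG : MeasurableSet G)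
    (hK : ∀ D, MeasurableSet D → P.map x₀ (G ∩ D) ≤ K * volume D) (T : ℕ) (r : ℝ) :
    P {ω | x₀ ω ∈ G ∧ ‖openLoopState f B γc s T (x₀ ω, fun t => w t ω)‖ ≤ r} ≤
      K * (volume (Metric.closedBall (0 : Vec N) r) / c ^ T) := by
  have hwm : Measurable (fun ω s => w s ω) := measurable_pi_lambda _ hw
  set E : Set (Vec N × (ℕ → Vec N)) := {S | S.1 ∈ G ∧ ‖openLoopState f B γc s T S‖ ≤ r}
  have hX := measurable_openLoopState (B := B) (γc := γc) (s := s) hf.continuous.measurable T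
  have hE : MeasurableSet E :=
    (measurable_fst hG).inter (measurableSet_le hX.norm measurable_const)
  have hmap := (indepFun_iff_map_prod_eq_prod_map_map hx₀.aemeasurable hwm.aemeasurable).1 hind
  have : IsProbabilityMeasure (P.map fun ω s => w s ω) :=
    Measure.isProbabilityMeasure_map hwm.aemeasurable
  have : IsProbabilityMeasure (P.map x₀) := Measure.isProbabilityMeasure_map hx₀.aemeasurable
  calc P {ω | x₀ ω ∈ G ∧ ‖openLoopState f B γc s T (x₀ ω, fun t => w t ω)‖ ≤ r}
      = P.map (fun ω => (x₀ ω, fun t => w t ω)) E := by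
        rw [Measure.map_apply (hx₀.prodMk hwm) hE]; rfl
    -- By independence the noise can be frozen while the law of `x₀` stays the same; the volume
    -- estimate is uniform in the frozen noise.
    _ = ∫⁻ v, P.map x₀ ((fun y => (y, v)) ⁻¹' E) ∂(P.map fun ω s => w s ω) := by
        rw [hmap, Measure.prod_apply_symm hE]
    _ ≤ ∫⁻ _, K * (volume (Metric.closedBall (0 : Vec N) r) / c ^ T)
          ∂(P.map fun ω s => w s ω) := by
        refine lintegral_mono fun v => ?_
        have hD : MeasurableSet
            {y | openLoopState f B γc s T (y, v) ∈ Metric.closedBall (0 : Vec N) r} :=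
          (hX.comp measurable_prodMk_right) measurableSet_closedBall
        have h1 := pow_mul_volume_openLoopState_le (B := B) (γc := γc) (s := s) hf hinj hc v T
          (D := Metric.closedBall 0 r) measurableSet_closedBall
        refine le_trans (le_of_eq ?_) ((hK _ hD).trans (mul_le_mul_right ?_ K))
        · congr 1; ext y; simp [E]
        · rw [ENNReal.le_div_iff_mul_le (Or.inl (pow_ne_zero _ hc0))
            (Or.inl (ENNReal.pow_ne_top hct)), mul_comm]
          exact h1
    _ = _ := by simp

end OpenLoop

/-- An absolutely continuous probability law has bounded density off a set of small measure. -/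
theorem exists_bounded_density {N : ℕ} (ρ : Measure (Vec N)) [IsProbabilityMeasure ρ]
    (hρ : ρ ≪ volume) {η : ENNReal} (hη : 0 < η) :
    ∃ K : ℕ, 0 < K ∧ ∃ G : Set (Vec N), MeasurableSet G ∧ ρ Gᶜ ≤ η ∧
      ∀ D, MeasurableSet D → ρ (G ∩ D) ≤ K * volume D := by
  set p := ρ.rnDeriv volume
  have hp : Measurable p := Measure.measurable_rnDeriv _ _
  have hG : ∀ n : ℕ, MeasurableSet {y | p y ≤ n} := fun n => measurableSet_le hp measurable_const
  have hlim : Tendsto (fun n : ℕ => ρ {y | p y ≤ n}ᶜ) atTop (𝓝 0) := by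
    have h := tendsto_measure_iInter_atTop (μ := ρ) (s := fun n : ℕ => {y | p y ≤ n}ᶜ)
      (fun n => (hG n).compl.nullMeasurableSet)
      (fun a b hab => Set.compl_subset_compl.2 fun y hy =>
        le_trans (b := (a : ENNReal)) hy (by exact_mod_cast hab))
      ⟨0, measure_ne_top _ _⟩
    -- The intersection is the set where the density is infinite.
    have h0 : ρ (⋂ n : ℕ, {y | p y ≤ n}ᶜ) = 0 := by
      have hlt : ∀ᵐ y ∂ρ, p y < ⊤ := hρ.ae_le (Measure.rnDeriv_lt_top ρ volume)
      refine measure_mono_null (fun y hy => ?_) (ae_iff.1 hlt)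
      simp only [Set.mem_iInter, Set.mem_compl_iff, Set.mem_ofPred_eq, not_le] at hy
      intro hy'
      obtain ⟨n, hn⟩ := ENNReal.exists_nat_gt hy'.ne
      exact (hn.trans (hy n)).false
    rwa [h0] at h
  obtain ⟨n, hn, hn0⟩ := ((hlim.eventually (ge_mem_nhds hη)).and (eventually_gt_atTop 0)).exists
  refine ⟨n, hn0, _, hG n, hn, fun D hD => ?_⟩
  rw [← Measure.withDensity_rnDeriv_eq ρ volume hρ, withDensity_apply _ ((hG n).inter hD)]
  calc ∫⁻ y in {y | p y ≤ n} ∩ D, p y ≤ ∫⁻ _ in {y | p y ≤ n} ∩ D, (n : ENNReal) :=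
        setLIntegral_mono measurable_const fun y hy => hy.1
    _ = n * volume ({y | p y ≤ n} ∩ D) := setLIntegral_const _ _
    _ ≤ n * volume D := by gcongr; exact Set.inter_subset_right

/-! ### Initial segments of input and output sequences -/

section Histories

variable {Ω α : Type*}

theorem hist_succ_eq_iff (X : ℕ → Ω → α) (n : ℕ) (ω : Ω) (s : Fin (n + 1) → α) :
    hist X (n + 1) ω = s ↔ hist X n ω = Fin.init s ∧ X n ω = s (Fin.last n) := by
  constructor
  · rintro rfl; exact ⟨rfl, rfl⟩
  · rintro ⟨h1, h2⟩
    funext i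
    induction i using Fin.lastCases with
    | last => exact h2
    | cast i => exact congrFun h1 i

theorem measurable_hist {m : MeasurableSpace Ω} [MeasurableSpace α] {X : ℕ → Ω → α} {n : ℕ}
    (hX : ∀ i < n, Measurable[m] (X i)) : Measurable[m] (hist X n) :=
  measurable_pi_lambda _ fun i => hX i i.isLt

theorem measurable_of_measurable_hist {m : MeasurableSpace Ω} [MeasurableSpace α] {X : ℕ → Ω → α}
    {n : ℕ} (hX : Measurable[m] (hist X n)) {i : ℕ} (hi : i < n) : Measurable[m] (X i) :=
  (measurable_pi_apply (⟨i, hi⟩ : Fin n)).comp hX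

end Histories

/-- If `k` is a version of the conditional probability of `E` given `m`, then the indicator of
`E` may be replaced by `k` in integrals of `m`-measurable functions. -/
theorem setLIntegral_eq_of_condExp {Ω : Type*} {m mΩ : MeasurableSpace Ω} (hm : m ≤ mΩ)
    {P : Measure Ω} [IsFiniteMeasure P] {E : Set Ω} (hE : MeasurableSet E) {k : Ω → ENNReal}
    (hk : Measurable k) (hk1 : ∀ ω, k ω ≤ 1) (h : P⟦E | m⟧ =ᵐ[P] fun ω => (k ω).toReal)
    {g : Ω → ENNReal} (hg : Measurable[m] g) :
    ∫⁻ ω in E, g ω ∂P = ∫⁻ ω, k ω * g ω ∂P := by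
  -- The defining property of conditional probability, P(E ∩ F) = ∫_F k for F in `m`, says that the
  -- two measures agree on `m`.
  have key : (P.restrict E).trim hm = (P.withDensity k).trim hm := by
    refine @Measure.ext _ m _ _ fun F hF => ?_
    rw [trim_measurableSet_eq hm hF, trim_measurableSet_eq hm hF,
      Measure.restrict_apply (hm _ hF), withDensity_apply _ (hm _ hF)]
    have hint : Integrable (E.indicator fun _ => (1 : ℝ)) P :=
      (integrable_const 1).indicator hE
    have h1 := setIntegral_condExp hm hint hF
    rw [setIntegral_congr_ae (hm _ hF) (h.mono fun ω hω _ => hω),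
      integral_indicator_const _ hE, integral_toReal hk.aemeasurable
        (Eventually.of_forall fun ω => (hk1 ω).trans_lt ENNReal.one_lt_top)] at h1
    rw [measureReal_restrict_apply hE, smul_eq_mul, mul_one, measureReal_def,
      ENNReal.toReal_eq_toReal_iff' _ (measure_ne_top _ _)] at h1
    · rw [h1, Set.inter_comm]
    · refine ((lintegral_mono hk1).trans_lt ?_).ne
      simp
  calc ∫⁻ ω in E, g ω ∂P = ∫⁻ ω, g ω ∂((P.restrict E).trim hm) := (lintegral_trim hm hg).symm
    _ = ∫⁻ ω, g ω ∂(P.withDensity k) := by rw [key, lintegral_trim hm hg]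
    _ = _ := lintegral_withDensity_eq_lintegral_mul _ hk (hg.mono hm le_rfl)

/-! ### The channel likelihood of an output string -/

section Likelihood

variable {Ω A A' : Type*} {W : Channel A A'} {q : ℕ → Ω → A} {q' : ℕ → Ω → A'}

/-- The likelihood `∏_{t<T} W_t(q'_t | q_{[0,t]}, q'_{[0,t-1]})`. -/
def likelihood (W : Channel A A') (q : ℕ → Ω → A) (q' : ℕ → Ω → A') (T : ℕ) (ω : Ω) : ENNReal :=
  ∏ t ∈ Finset.range T, W t (hist q (t + 1) ω) (hist q' t ω) (q' t ω)

theorem likelihood_ne_top (T : ℕ) (ω : Ω) : likelihood W q q' T ω ≠ ⊤ :=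
  ENNReal.prod_ne_top fun _ _ => PMF.apply_ne_top _ _

variable [Fintype A] [MeasurableSpace A] [MeasurableSingletonClass A]
    [Fintype A'] [MeasurableSpace A'] [MeasurableSingletonClass A']

theorem measurable_channel {m : MeasurableSpace Ω} {t : ℕ} {b : Ω → A'}
    (hq : Measurable[m] (hist q (t + 1))) (hq' : Measurable[m] (hist q' t)) (hb : Measurable[m] b) :
    Measurable[m] fun ω => W t (hist q (t + 1) ω) (hist q' t ω) (b ω) :=
  (Measurable.of_discrete
    (f := fun z : (Fin (t + 1) → A) × (Fin t → A') × A' => W t z.1 z.2.1 z.2.2)).comp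
    (hq.prodMk (hq'.prodMk hb))

theorem measurable_likelihood {m : MeasurableSpace Ω} {T : ℕ}
    (hq : ∀ i < T, Measurable[m] (q i)) (hq' : ∀ i < T, Measurable[m] (q' i)) :
    Measurable[m] (likelihood W q q' T) :=
  Finset.measurable_fun_prod _ fun t ht => by
    have ht := Finset.mem_range.1 ht
    exact measurable_channel (measurable_hist fun i hi => hq i (by omega))
      (measurable_hist fun i hi => hq' i (by omega)) (hq' t ht)

end Likelihood

theorem channelPast_le {Ω A A' : Type*} {mΩ : MeasurableSpace Ω} [MeasurableSpace A] [MeasurableSpace A']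
    {q : ℕ → Ω → A} {q' : ℕ → Ω → A'}
    (hq : ∀ t, Measurable (q t)) (hq' : ∀ t, Measurable (q' t)) (t : ℕ) :
    channelPast q q' t ≤ mΩ :=
  sup_le (measurable_hist fun i _ => hq i).comap_le (measurable_hist fun i _ => hq' i).comap_le

/-! ### Closed-loop laws and change of measure by the inverse likelihood -/

section ChannelUse

variable {Ω A A' : Type*} [mΩ : MeasurableSpace Ω]
    [Fintype A] [MeasurableSpace A] [MeasurableSingletonClass A]
    [Fintype A'] [MeasurableSpace A'] [MeasurableSingletonClass A']
    {P : Measure Ω} [IsProbabilityMeasure P] {W : Channel A A'}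
    {q : ℕ → Ω → A} {q' : ℕ → Ω → A'}

/-- Transition probabilities of the channel outputs. -/
theorem measure_output_eq (hq : ∀ t, Measurable (q t)) (hq' : ∀ t, Measurable (q' t))
    (hW : ∀ t (b : A'), P⟦q' t ⁻¹' {b} | channelPast q q' t⟧ =ᵐ[P]
      fun ω => (W t (hist q (t + 1) ω) (hist q' t ω) b).toReal)
    (t : ℕ) (a : Fin (t + 1) → A) (s : Fin t → A') (b : A') :
    P {ω | q' t ω = b ∧ hist q (t + 1) ω = a ∧ hist q' t ω = s} =
      W t a s b * P {ω | hist q (t + 1) ω = a ∧ hist q' t ω = s} := by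
  have hm := channelPast_le hq hq' t
  set F := {ω | hist q (t + 1) ω = a ∧ hist q' t ω = s}
  have hF : MeasurableSet[channelPast q q' t] F :=
    MeasurableSet.inter (le_sup_left (a := MeasurableSpace.comap (hist q (t + 1)) inferInstance) _
      ⟨{a}, measurableSet_singleton a, rfl⟩)
      (le_sup_right (b := MeasurableSpace.comap (hist q' t) inferInstance) _
      ⟨{s}, measurableSet_singleton s, rfl⟩)
  have hE : MeasurableSet (q' t ⁻¹' {b}) := hq' t (measurableSet_singleton b)
  have h := setLIntegral_eq_of_condExp hm hE
    (measurable_channel (measurable_hist fun i _ => hq i) (measurable_hist fun i _ => hq' i)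
      measurable_const)
    (fun ω => PMF.coe_le_one _ _) (hW t b) (g := F.indicator 1)
    ((measurable_const (a := (1 : ENNReal))).indicator hF)
  rw [lintegral_indicator_one (hm _ hF), Measure.restrict_apply (hm _ hF)] at h
  have h2 : ∀ ω, W t (hist q (t + 1) ω) (hist q' t ω) b * F.indicator 1 ω =
      F.indicator (fun _ => W t a s b) ω := by
    intro ω
    by_cases hω : ω ∈ F
    · rw [Set.indicator_of_mem hω, Set.indicator_of_mem hω, hω.1, hω.2, Pi.one_apply, mul_one]
    · rw [Set.indicator_of_notMem hω, Set.indicator_of_notMem hω, mul_zero]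
  simp only [h2] at h
  rw [lintegral_indicator_const (hm _ hF)] at h
  rw [← h, Set.inter_comm]
  rfl

/-- The law of inputs and outputs in closed loop is produced by some input kernels. -/
theorem exists_inputKernels (hq : ∀ t, Measurable (q t)) (hq' : ∀ t, Measurable (q' t))
    (hW : ∀ t (b : A'), P⟦q' t ⁻¹' {b} | channelPast q q' t⟧ =ᵐ[P]
      fun ω => (W t (hist q (t + 1) ω) (hist q' t ω) b).toReal) :
    ∃ π : InputKernels A A', ∀ T h,
      jointLaw W π T h = P ((fun ω => (hist q T ω, hist q' T ω)) ⁻¹' {h}) := by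
  classical
  have hne : Nonempty A := ⟨q 0 P.nonempty_of_neZero.some⟩
  have hH : ∀ T, Measurable fun ω => (hist q T ω, hist q' T ω) := fun T =>
    (measurable_hist fun i _ => hq i).prodMk (measurable_hist fun i _ => hq' i)
  -- The product form leaves the kernel arbitrary after a history of probability zero.
  have hπ : ∀ t (a : Fin t → A) (s : Fin t → A'), ∃ π : PMF A, ∀ c,
      P ((fun ω => (hist q t ω, hist q' t ω)) ⁻¹' {(a, s)}) * π c =
        P ((fun ω => (hist q t ω, hist q' t ω)) ⁻¹' {(a, s)} ∩ q t ⁻¹' {c}) := by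
    intro t a s
    set F := (fun ω => (hist q t ω, hist q' t ω)) ⁻¹' {(a, s)}
    by_cases h0 : P F = 0
    · refine ⟨PMF.pure hne.some, fun c => ?_⟩
      rw [h0, zero_mul, measure_mono_null Set.inter_subset_left h0]
    · have := cond_isProbabilityMeasure h0
      have : IsProbabilityMeasure ((P[|F]).map (q t)) :=
        Measure.isProbabilityMeasure_map (hq t).aemeasurable
      refine ⟨((P[|F]).map (q t)).toPMF, fun c => ?_⟩
      rw [Measure.toPMF_apply, Measure.map_apply (hq t) (measurableSet_singleton c), mul_comm,
        cond_mul_eq_inter (hH t (measurableSet_singleton _)) _ P]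
  choose π hπ using hπ
  refine ⟨π, fun T => ?_⟩
  induction T with
  | zero =>
    intro h
    have hall : ∀ g : (Fin 0 → A) × (Fin 0 → A'), g = h := fun g => Subsingleton.elim _ _
    have : (fun ω => (hist q 0 ω, hist q' 0 ω)) ⁻¹' {h} = Set.univ :=
      Set.eq_univ_of_forall fun ω => hall _
    rw [this, measure_univ, jointLaw, PMF.pure_apply, if_pos (hall _).symm]
  | succ T ih =>
    rintro ⟨a', s'⟩
    -- A string determines its initial segment and last letter, so one term survives in each of the
    -- three nested sums.
    have hstep : jointLaw W π (T + 1) (a', s') =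
        jointLaw W π T (Fin.init a', Fin.init s') *
          (π T (Fin.init a') (Fin.init s') (a' (Fin.last T)) *
            W T a' (Fin.init s') (s' (Fin.last T))) := by
      rw [jointLaw, PMF.bind_apply, tsum_eq_single (Fin.init a', Fin.init s')]
      · rw [PMF.bind_apply, tsum_eq_single (a' (Fin.last T))]
        · rw [PMF.map_apply, tsum_eq_single (s' (Fin.last T))]
          · simp
          · intro b hb
            refine if_neg fun h => hb ?_
            have := congrFun (congrArg Prod.snd h) (Fin.last T)
            simpa using this.symm
        · intro c hc
          rw [PMF.map_apply, ENNReal.tsum_eq_zero.2, mul_zero]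
          intro b
          refine if_neg fun h => hc ?_
          have := congrFun (congrArg Prod.fst h) (Fin.last T)
          simpa using this.symm
      · rintro ⟨a, s⟩ has
        rw [PMF.bind_apply, ENNReal.tsum_eq_zero.2, mul_zero]
        intro c
        rw [PMF.map_apply, ENNReal.tsum_eq_zero.2, mul_zero]
        intro b
        refine if_neg fun h => has ?_
        rw [Prod.mk.injEq] at h
        rw [h.1, h.2, Fin.init_snoc, Fin.init_snoc]
    rw [hstep, ih, ← mul_assoc, hπ]
    have h1 : ((fun ω => (hist q T ω, hist q' T ω)) ⁻¹' {(Fin.init a', Fin.init s')} ∩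
        q T ⁻¹' {a' (Fin.last T)}) =
        {ω | hist q (T + 1) ω = a' ∧ hist q' T ω = Fin.init s'} := by
      ext ω
      simp only [hist_succ_eq_iff, Set.mem_inter_iff, Set.mem_preimage, Set.mem_singleton_iff,
        Prod.mk.injEq, Set.mem_ofPred_eq]
      tauto
    have h2 : (fun ω => (hist q (T + 1) ω, hist q' (T + 1) ω)) ⁻¹' {(a', s')} =
        {ω | q' T ω = s' (Fin.last T) ∧ hist q (T + 1) ω = a' ∧ hist q' T ω = Fin.init s'} := by
      ext ω
      simp only [hist_succ_eq_iff q', Set.mem_preimage, Set.mem_singleton_iff,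
        Prod.mk.injEq, Set.mem_ofPred_eq]
      tauto
    rw [h1, h2, measure_output_eq hq hq' hW, mul_comm]

/-- Integrals over an output string, weighted by the inverse likelihood. -/
theorem setLIntegral_div_likelihood_le {β : Type*} [MeasurableSpace β] {S : Ω → β}
    (hq : ∀ t, Measurable (q t)) (hq' : ∀ t, Measurable (q' t)) {σ : MeasurableSpace Ω}
    (hσ : σ ≤ mΩ) (hS : Measurable[σ] S)
    (hW : ∀ t (b : A'), P⟦q' t ⁻¹' {b} | channelPast q q' t ⊔ σ⟧ =ᵐ[P]
      fun ω => (W t (hist q (t + 1) ω) (hist q' t ω) b).toReal)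
    (T : ℕ) (s : Fin T → A') {g : β → ENNReal} (hg : Measurable g) :
    ∫⁻ ω in {ω | hist q' T ω = s}, g (S ω) * (likelihood W q q' T ω)⁻¹ ∂P ≤
      ∫⁻ ω, g (S ω) ∂P := by
  induction T with
  | zero =>
    refine (setLIntegral_le_lintegral _ _).trans (le_of_eq ?_)
    simp [likelihood]
  | succ T ih =>
    set b := s (Fin.last T)
    set m := channelPast q q' T ⊔ σ
    have hm : m ≤ mΩ := sup_le (channelPast_le hq hq' T) hσ
    have hqm : Measurable[m] (hist q (T + 1)) :=
      (comap_measurable _).mono (le_sup_left.trans le_sup_left) le_rfl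
    have hqm' : Measurable[m] (hist q' T) :=
      (comap_measurable _).mono (le_sup_right.trans le_sup_left) le_rfl
    set F := {ω | hist q' T ω = Fin.init s}
    have hF : MeasurableSet[m] F := hqm' (measurableSet_singleton _)
    set k : Ω → ENNReal := fun ω => W T (hist q (T + 1) ω) (hist q' T ω) b
    have hk : Measurable[m] k := measurable_channel hqm hqm' measurable_const
    set G : Ω → ENNReal := F.indicator fun ω => g (S ω) * (likelihood W q q' T ω)⁻¹
    have hgS : Measurable[m] fun ω => g (S ω) := hg.comp (hS.mono le_sup_right le_rfl)
    have hlik : Measurable[m] (likelihood W q q' T) := measurable_likelihood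
      (fun i hi => measurable_of_measurable_hist hqm (by omega))
      (fun i hi => measurable_of_measurable_hist hqm' hi)
    have h : Measurable[m] fun ω => g (S ω) * (likelihood W q q' T ω)⁻¹ := hgS.mul hlik.inv
    have hG : Measurable[m] G := h.indicator hF
    have hE : MeasurableSet[mΩ] (q' T ⁻¹' {b}) := hq' T (measurableSet_singleton b)
    have hset : {ω | hist q' (T + 1) ω = s} = F ∩ q' T ⁻¹' {b} := by
      ext ω; exact hist_succ_eq_iff _ _ _ _
    -- Conditioning on past and source turns the event of the last output into the factor `k`, which
    -- cancels the last factor of the inverse likelihood. Only `≤` results, because `k` may vanish.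
    calc ∫⁻ ω in {ω | hist q' (T + 1) ω = s}, g (S ω) * (likelihood W q q' (T + 1) ω)⁻¹ ∂P
        = ∫⁻ ω in F ∩ q' T ⁻¹' {b}, G ω * (k ω)⁻¹ ∂P := by
          rw [hset]
          refine setLIntegral_congr_fun ((hm _ hF).inter hE) fun ω hω => ?_
          simp only [G, k]
          have h : likelihood W q q' (T + 1) ω = likelihood W q q' T ω * k ω := by
            rw [likelihood, Finset.prod_range_succ, show q' T ω = b from hω.2]; rfl
          rw [Set.indicator_of_mem hω.1, h, ENNReal.mul_inv (Or.inr (PMF.apply_ne_top _ _))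
            (Or.inl (likelihood_ne_top T ω)), mul_assoc]
      _ ≤ ∫⁻ ω in q' T ⁻¹' {b}, G ω * (k ω)⁻¹ ∂P := lintegral_mono_set Set.inter_subset_right
      _ = ∫⁻ ω, k ω * (G ω * (k ω)⁻¹) ∂P :=
          setLIntegral_eq_of_condExp hm hE (hk.mono hm le_rfl) (fun ω => PMF.coe_le_one _ _)
            (hW T b) (hG.mul hk.inv)
      _ ≤ ∫⁻ ω, G ω ∂P := by
          refine lintegral_mono fun ω => ?_
          rw [mul_left_comm]
          exact mul_le_of_le_one_right' (ENNReal.mul_inv_le_one _)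
      _ = ∫⁻ ω in F, g (S ω) * (likelihood W q q' T ω)⁻¹ ∂P := lintegral_indicator (hm _ hF) _
      _ ≤ _ := ih _

end ChannelUse

/-! ### Null fibres and integrability for finitely many values -/

section FiniteValued

variable {Ω α : Type*} [MeasurableSpace Ω] [Finite α]

/-- The exceptional points lie in a finite union of null fibres. This justifies, almost everywhere,
dividing by the probability of the observed value and taking its logarithm. -/
theorem ae_measureReal_fiber_ne_zero (P : Measure Ω) [IsFiniteMeasure P] (V : Ω → α) :
    ∀ᵐ ω ∂P, P.real {ω' | V ω' = V ω} ≠ 0 := by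
  refine measure_mono_null (t := ⋃ v ∈ {v | P {ω' | V ω' = v} = 0}, {ω' | V ω' = v})
    (fun ω hω => ?_) ((measure_biUnion_null_iff (Set.to_countable _)).2 fun v hv => hv)
  have h0 : P.real {ω' | V ω' = V ω} = 0 := not_not.1 hω
  exact Set.mem_biUnion (x := V ω) ((measureReal_eq_zero_iff).1 h0) rfl

theorem integrable_comp_finite [MeasurableSpace α] [MeasurableSingletonClass α] (P : Measure Ω)
    [IsFiniteMeasure P] {V : Ω → α} (hV : Measurable V) (F : α → ℝ) :
    Integrable (fun ω => F (V ω)) P := by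
  have : Integrable F (P.map V) := Integrable.of_finite
  exact this.comp_measurable hV

end FiniteValued

/-! ### Directed information and the converse bound -/

section DirectedInfo

variable {Ω A A' : Type*} [mΩ : MeasurableSpace Ω]
    [Fintype A] [MeasurableSpace A] [MeasurableSingletonClass A]
    [Fintype A'] [MeasurableSpace A'] [MeasurableSingletonClass A']
    {P : Measure Ω} [IsProbabilityMeasure P] {W : Channel A A'}
    {q : ℕ → Ω → A} {q' : ℕ → Ω → A'}

/-- Directed information as the expected log-likelihood ratio of channel outputs. -/
theorem directedInfo_mul_log_two (hq : ∀ t, Measurable (q t)) (hq' : ∀ t, Measurable (q' t))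
    (hW : ∀ t (b : A'), P⟦q' t ⁻¹' {b} | channelPast q q' t⟧ =ᵐ[P]
      fun ω => (W t (hist q (t + 1) ω) (hist q' t ω) b).toReal)
    {T : ℕ} {p : PMF ((Fin T → A) × (Fin T → A'))}
    (hp : ∀ h, p h = P ((fun ω => (hist q T ω, hist q' T ω)) ⁻¹' {h})) :
    directedInfo p * Real.log 2 = ∫ ω, (Real.log (likelihood W q q' T ω).toReal -
      Real.log (P.real {ω' | hist q' T ω' = hist q' T ω})) ∂P := by
  set pr : ℕ → Ω → ℝ := fun t ω => P.real {ω' | hist q' t ω' = hist q' t ω} with hpr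
  set k : ℕ → Ω → ℝ := fun t ω => (W t (hist q (t + 1) ω) (hist q' t ω) (q' t ω)).toReal with hk
  have hHm : Measurable fun ω => (hist q T ω, hist q' T ω) :=
    (measurable_hist fun i _ => hq i).prodMk (measurable_hist fun i _ => hq' i)
  have hlog2 : Real.log 2 ≠ 0 := (Real.log_pos one_lt_two).ne'
  have hpr0 : ∀ᵐ ω ∂P, ∀ t, pr t ω ≠ 0 :=
    ae_all_iff.2 fun t => ae_measureReal_fiber_ne_zero P (hist q' t)
  have hfac : ∀ t ω, P.real {ω' | q' t ω' = q' t ω ∧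
      (hist q (t + 1) ω', hist q' t ω') = (hist q (t + 1) ω, hist q' t ω)} =
      k t ω * P.real {ω' | (hist q (t + 1) ω', hist q' t ω') =
        (hist q (t + 1) ω, hist q' t ω)} := by
    intro t ω
    simp only [hk, measureReal_def, ← ENNReal.toReal_mul, Prod.mk.injEq]
    rw [measure_output_eq hq hq' hW]
  -- A zero transition probability would make the observed inputs and outputs an event of
  -- probability zero.
  have hk0 : ∀ᵐ ω ∂P, ∀ t, k t ω ≠ 0 := by
    refine ae_all_iff.2 fun t => ?_
    filter_upwards [ae_measureReal_fiber_ne_zero P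
      (fun ω => (q' t ω, hist q (t + 1) ω, hist q' t ω))] with ω hω h0
    refine hω ?_
    have := hfac t ω
    rw [h0, zero_mul] at this
    rw [← this]
    simp only [Prod.mk.injEq]
  have hpast0 : ∀ᵐ ω ∂P, ∀ t, P.real {ω' | (hist q (t + 1) ω', hist q' t ω') =
        (hist q (t + 1) ω, hist q' t ω)} ≠ 0 :=
    ae_all_iff.2 fun t =>
      ae_measureReal_fiber_ne_zero P fun ω => (hist q (t + 1) ω, hist q' t ω)
  have hprI : ∀ t, Integrable (fun ω => Real.log (pr t ω)) P := fun t =>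
    integrable_comp_finite P (measurable_hist fun i _ => hq' i)
      (fun s => Real.log (P.real {ω' | hist q' t ω' = s}))
  have hdI : ∀ t, Integrable (fun ω => Real.log (pr (t + 1) ω) - Real.log (pr t ω)) P := fun t =>
    (hprI (t + 1)).sub (hprI t)
  have hkI : ∀ t, Integrable (fun ω => Real.log (k t ω)) P := fun t =>
    integrable_comp_finite P ((measurable_hist (n := t + 1) fun i _ => hq i).prodMk
      ((measurable_hist (n := t) fun i _ => hq' i).prodMk (hq' t)))
      (fun v => Real.log (W t v.1 v.2.1 v.2.2).toReal)
  have hsI : ∀ t, Integrable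
      (fun ω => Real.log (k t ω) - (Real.log (pr (t + 1) ω) - Real.log (pr t ω))) P := fun t =>
    (hkI t).sub (hdI t)
  have hterm : ∀ t : Fin T, condMutualInfo p
      (fun h (i : Fin (t + 1)) => h.1 (Fin.castLE t.isLt i))
      (fun h => h.2 t)
      (fun h (i : Fin t) => h.2 (Fin.castLE t.isLt.le i)) * Real.log 2 =
      ∫ ω, (Real.log (k t ω) - (Real.log (pr (t + 1) ω) - Real.log (pr t ω))) ∂P := by
    intro t
    have hms := fun v => hHm (measurableSet_singleton v)
    rw [condMutualInfo, condEntropy_eq_integral P p _ hms hp,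
      condEntropy_eq_integral P p _ hms hp, sub_neg_eq_add, neg_add_eq_sub, sub_mul,
      integral_sub (hkI t) (hdI t), ← integral_mul_const,
      ← integral_mul_const]
    congr 1
    · refine integral_congr_ae ?_
      filter_upwards [hpast0] with ω hω
      have h : P.real {ω' | q' t ω' = q' t ω ∧
          (hist q (t + 1) ω', hist q' t ω') = (hist q (t + 1) ω, hist q' t ω)} /
          P.real {ω' | (hist q (t + 1) ω', hist q' t ω') = (hist q (t + 1) ω, hist q' t ω)} =
          k t ω := by rw [hfac, mul_div_cancel_right₀ _ (hω t)]
      rw [Real.logb, div_mul_cancel₀ _ hlog2, ← h]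
      rfl
    · refine integral_congr_ae ?_
      filter_upwards [hpr0] with ω hω
      have h : {ω' | hist q' (t + 1) ω' = hist q' (t + 1) ω} =
          {ω' | q' t ω' = q' t ω ∧ hist q' t ω' = hist q' t ω} := by
        ext ω'
        simp only [Set.mem_ofPred_eq, hist_succ_eq_iff]
        exact and_comm
      rw [Real.logb, div_mul_cancel₀ _ hlog2, ← Real.log_div (hω _) (hω _)]
      simp only [hpr, h]
      rfl
  rw [directedInfo, Finset.sum_mul, Finset.sum_congr rfl fun t _ => hterm t,
    ← integral_finsetSum _ fun (t : Fin T) _ => hsI t]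
  refine integral_congr_ae ?_
  filter_upwards [hk0] with ω hω
  -- The output terms telescope from the empty string, of probability 1, to the full string; the
  -- channel terms add up to the log-likelihood.
  rw [Fin.sum_univ_eq_sum_range
      (fun t => Real.log (k t ω) - (Real.log (pr (t + 1) ω) - Real.log (pr t ω))),
    Finset.sum_sub_distrib, Finset.sum_range_sub (fun t => Real.log (pr t ω)),
    ← Real.log_prod fun t _ => hω t, likelihood, ENNReal.toReal_prod]
  have : pr 0 ω = 1 := by
    have : {ω' | hist q' 0 ω' = hist q' 0 ω} = Set.univ :=
      Set.eq_univ_of_forall fun ω' => Subsingleton.elim _ _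
    simp only [hpr, this, probReal_univ]
  rw [this, Real.log_one, sub_zero]

theorem ae_likelihood_ne_zero (hq : ∀ t, Measurable (q t)) (hq' : ∀ t, Measurable (q' t))
    (hW : ∀ t (b : A'), P⟦q' t ⁻¹' {b} | channelPast q q' t⟧ =ᵐ[P]
      fun ω => (W t (hist q (t + 1) ω) (hist q' t ω) b).toReal) (T : ℕ) :
    ∀ᵐ ω ∂P, likelihood W q q' T ω ≠ 0 := by
  have h : ∀ᵐ ω ∂P, ∀ t, W t (hist q (t + 1) ω) (hist q' t ω) (q' t ω) ≠ 0 := by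
    refine ae_all_iff.2 fun t => ?_
    filter_upwards [ae_measureReal_fiber_ne_zero P
      (fun ω => (q' t ω, hist q (t + 1) ω, hist q' t ω))] with ω hω h0
    refine hω ?_
    simp only [Prod.mk.injEq]
    rw [measureReal_def, measure_output_eq hq hq' hW, h0, zero_mul, ENNReal.toReal_zero]
  filter_upwards [h] with ω hω
  exact Finset.prod_ne_zero_iff.2 fun t _ => hω t

theorem integrable_log_likelihood (P : Measure Ω) [IsFiniteMeasure P]
    (hq : ∀ t, Measurable (q t)) (hq' : ∀ t, Measurable (q' t)) (T : ℕ) :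
    Integrable (fun ω => Real.log (likelihood W q q' T ω).toReal) P := by
  have h := integrable_comp_finite (α := (t : Fin T) → (Fin (t + 1) → A) × (Fin t → A') × A') P
    (V := fun ω (t : Fin T) => (hist q (t + 1) ω, hist q' t ω, q' t ω))
    (measurable_pi_lambda _ fun t => (measurable_hist fun i _ => hq i).prodMk
      ((measurable_hist fun i _ => hq' i).prodMk (hq' t)))
    (fun v => Real.log (∏ t : Fin T, W t (v t).1 (v t).2.1 (v t).2.2).toReal)
  simp only [likelihood, Finset.prod_range]
  exact h

/-- Converse bound: if an event depending on a source `S` and the channel outputs has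
probability at most `ε` for every fixed output string, its closed-loop probability is limited by
the directed information. -/
theorem measureReal_mul_log_le_directedInfo {β : Type*} [MeasurableSpace β] {S : Ω → β}
    (hq : ∀ t, Measurable (q t)) (hq' : ∀ t, Measurable (q' t)) (hS : Measurable S)
    (hW : ∀ t (b : A'), P⟦q' t ⁻¹' {b} | channelPast q q' t⟧ =ᵐ[P]
      fun ω => (W t (hist q (t + 1) ω) (hist q' t ω) b).toReal)
    {T : ℕ} {p : PMF ((Fin T → A) × (Fin T → A'))}
    (hp : ∀ h, p h = P ((fun ω => (hist q T ω, hist q' T ω)) ⁻¹' {h}))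
    (hlik : ∀ (s : Fin T → A') (g : β → ENNReal), Measurable g →
      ∫⁻ ω in {ω | hist q' T ω = s}, g (S ω) * (likelihood W q q' T ω)⁻¹ ∂P ≤ ∫⁻ ω, g (S ω) ∂P)
    {D : (Fin T → A') → Set β} (hD : ∀ s, MeasurableSet (D s)) {ε : ℝ} (hε : 0 < ε)
    (hDε : ∀ s, P {ω | S ω ∈ D s} ≤ ENNReal.ofReal ε) :
    P.real {ω | S ω ∈ D (hist q' T ω)} * Real.log ε⁻¹ ≤ directedInfo p * Real.log 2 + 1 := by
  classical
  have hqm' : Measurable (hist q' T) := measurable_hist fun i _ => hq' i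
  have hKm : Measurable (likelihood W q q' T) :=
    measurable_likelihood (fun i _ => hq i) (fun i _ => hq' i)
  set E : Set Ω := {ω | S ω ∈ D (hist q' T ω)}
  have hEeq : E = ⋃ s, {ω | hist q' T ω = s} ∩ {ω | S ω ∈ D s} := by
    ext ω; simp [E]
  have hfib : ∀ s, MeasurableSet {ω | hist q' T ω = s} := fun s =>
    hqm' (measurableSet_singleton s)
  have hE : MeasurableSet E := by
    rw [hEeq]; exact MeasurableSet.iUnion fun s => (hfib s).inter (hS (hD s))
  set pr : Ω → ℝ := fun ω => P.real {ω' | hist q' T ω' = hist q' T ω}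
  set K : Ω → ℝ := fun ω => (likelihood W q q' T ω).toReal
  -- The integral of log `e` is P(E) · log ε⁻¹, the quantity to be bounded. Below, `pr / K` acts as
  -- the density of the decoupled reference law.
  set e : Ω → ℝ := E.piecewise (fun _ => ε⁻¹) (fun _ => 1)
  have he : ∀ ω, 0 < e ω := by
    intro ω
    by_cases hω : ω ∈ E
    · simp only [e, Set.piecewise_eq_of_mem _ _ _ hω]; positivity
    · simp only [e, Set.piecewise_eq_of_notMem _ _ _ hω]; positivity
  have hem : Measurable e := Measurable.piecewise hE measurable_const measurable_const
  have hprm : Measurable pr :=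
    (Measurable.of_discrete (f := fun s => P.real {ω' | hist q' T ω' = s})).comp hqm'
  set Z : Ω → ℝ := fun ω => e ω * (pr ω / K ω)
  have hZm : Measurable Z := hem.mul (hprm.div hKm.ennreal_toReal)
  have hZ0 : ∀ ω, 0 ≤ Z ω := fun ω =>
    mul_nonneg (he ω).le (div_nonneg measureReal_nonneg ENNReal.toReal_nonneg)
  -- The 2 is 1 + ε⁻¹ · ε: the constant part of `e` contributes at most 1, and so does the event,
  -- whose probability is at most ε for each fixed output string.
  have hlint : ∫⁻ ω, ENNReal.ofReal (Z ω) ∂P ≤ 2 := by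
    have hsplit : ∫⁻ ω, ENNReal.ofReal (Z ω) ∂P =
        ∑ s, ∫⁻ ω in {ω | hist q' T ω = s}, ENNReal.ofReal (Z ω) ∂P := by
      rw [← setLIntegral_univ, ← lintegral_biUnion_finset _ fun s _ => hfib s]
      · congr 2
        ext ω; simp
      · intro s _ s' _ hss
        exact Set.disjoint_left.2 fun ω h h' => hss (h.symm.trans h')
    have hpiece : ∀ s, ∫⁻ ω in {ω | hist q' T ω = s}, ENNReal.ofReal (Z ω) ∂P ≤
        P {ω | hist q' T ω = s} * 2 := by
      intro s
      set g : β → ENNReal := fun y => 1 + (D s).indicator (fun _ => ENNReal.ofReal ε⁻¹) y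
      have hg : Measurable g := Measurable.add measurable_const
        ((measurable_const (a := ENNReal.ofReal ε⁻¹)).indicator (hD s))
      have hgint : ∫⁻ ω, g (S ω) ∂P ≤ 2 := by
        have h1 : ∀ ω, g (S ω) =
            1 + {ω | S ω ∈ D s}.indicator (fun _ => ENNReal.ofReal ε⁻¹) ω := fun ω => rfl
        simp only [h1]
        rw [lintegral_add_left measurable_const, lintegral_const, measure_univ, mul_one,
          lintegral_indicator_const (s := {ω | S ω ∈ D s}) (hS (hD s)), ← one_add_one_eq_two]
        gcongr
        calc ENNReal.ofReal ε⁻¹ * P {ω | S ω ∈ D s}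
            ≤ ENNReal.ofReal ε⁻¹ * ENNReal.ofReal ε := by gcongr; exact hDε s
          _ = 1 := by
            rw [← ENNReal.ofReal_mul (by positivity), inv_mul_cancel₀ hε.ne', ENNReal.ofReal_one]
      calc ∫⁻ ω in {ω | hist q' T ω = s}, ENNReal.ofReal (Z ω) ∂P
          ≤ ∫⁻ ω in {ω | hist q' T ω = s},
            P {ω | hist q' T ω = s} * (g (S ω) * (likelihood W q q' T ω)⁻¹) ∂P := by
            refine setLIntegral_mono' (hfib s) fun ω hω => ?_
            have hω : hist q' T ω = s := hω
            have h1 : ENNReal.ofReal (e ω) ≤ g (S ω) := by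
              by_cases hωE : ω ∈ E
              · have : S ω ∈ D s := hω ▸ hωE
                simp only [e, g, Set.piecewise_eq_of_mem _ _ _ hωE, Set.indicator_of_mem this]
                exact le_add_self
              · simp only [e, g, Set.piecewise_eq_of_notMem _ _ _ hωE, ENNReal.ofReal_one]
                exact le_self_add
            have h2 : ENNReal.ofReal (pr ω) = P {ω | hist q' T ω = s} := by
              simp only [pr, hω, measureReal_def]
              exact ENNReal.ofReal_toReal (measure_ne_top _ _)
            -- Strict where the likelihood is 0: the real inverse is then 0, the extended one `⊤`.
            have h3 : ENNReal.ofReal (K ω)⁻¹ ≤ (likelihood W q q' T ω)⁻¹ := by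
              simp only [K, ← ENNReal.toReal_inv]
              exact ENNReal.ofReal_toReal_le
            simp only [Z, div_eq_mul_inv]
            rw [ENNReal.ofReal_mul (he ω).le, ENNReal.ofReal_mul measureReal_nonneg, h2,
              mul_left_comm]
            gcongr
        _ = P {ω | hist q' T ω = s} *
            ∫⁻ ω in {ω | hist q' T ω = s}, g (S ω) * (likelihood W q q' T ω)⁻¹ ∂P :=
            lintegral_const_mul' _ _ (measure_ne_top _ _)
        _ ≤ P {ω | hist q' T ω = s} * 2 := by
            gcongr
            exact (hlik s g hg).trans hgint
    calc ∫⁻ ω, ENNReal.ofReal (Z ω) ∂P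
        ≤ ∑ s, P {ω | hist q' T ω = s} * 2 := hsplit ▸ Finset.sum_le_sum fun s _ => hpiece s
      _ = 2 := by
        rw [← Finset.sum_mul]
        have := sum_measure_preimage_singleton (μ := P) (f := hist q' T) Finset.univ
          fun s _ => hfib s
        have h1 : ∑ s, P {ω | hist q' T ω = s} = 1 := by
          refine this.trans ?_
          simp
        rw [h1, one_mul]
  have hZI : Integrable Z P := by
    refine ⟨hZm.aestronglyMeasurable, ?_⟩
    rw [hasFiniteIntegral_iff_ofReal (Eventually.of_forall hZ0)]
    exact hlint.trans_lt (by simp)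
  have hZint : ∫ ω, Z ω ∂P ≤ 2 := by
    rw [integral_eq_lintegral_of_nonneg_ae (Eventually.of_forall hZ0) hZm.aestronglyMeasurable]
    exact ENNReal.toReal_le_of_le_ofReal zero_le_two (by simpa using hlint)
  have hlogI : Integrable (fun ω => Real.log (K ω) - Real.log (pr ω)) P :=
    (integrable_log_likelihood P hq hq' T).sub
      (integrable_comp_finite P hqm' fun s => Real.log (P.real {ω' | hist q' T ω' = s}))
  have hZI1 : Integrable (fun ω => Z ω - 1) P := hZI.sub (integrable_const 1)
  have heI : ∀ ω, Real.log (e ω) = E.indicator (fun _ => Real.log ε⁻¹) ω := by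
    intro ω
    by_cases hω : ω ∈ E
    · simp only [e, Set.piecewise_eq_of_mem _ _ _ hω, Set.indicator_of_mem hω]
    · simp only [e, Set.piecewise_eq_of_notMem _ _ _ hω, Set.indicator_of_notMem hω, Real.log_one]
  have hmain : ∫ ω, E.indicator (fun _ => Real.log ε⁻¹) ω ∂P ≤
      ∫ ω, ((Real.log (K ω) - Real.log (pr ω)) + (Z ω - 1)) ∂P := by
    refine integral_mono_ae ((integrable_const _).indicator hE)
      (hlogI.add hZI1) ?_
    filter_upwards [ae_likelihood_ne_zero hq hq' hW T,
      ae_measureReal_fiber_ne_zero P (hist q' T)] with ω hω1 hω2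
    have hK0 : K ω ≠ 0 := ENNReal.toReal_ne_zero.2 ⟨hω1, likelihood_ne_top T ω⟩
    have hKp : 0 < K ω := lt_of_le_of_ne ENNReal.toReal_nonneg hK0.symm
    have hprp : 0 < pr ω := lt_of_le_of_ne measureReal_nonneg (Ne.symm hω2)
    -- This is log Z ≤ Z - 1; integrated, the right side contributes at most 2 - 1, the additive
    -- constant of the conclusion.
    have h1 := Real.log_le_sub_one_of_pos (mul_pos (he ω) (div_pos hprp hKp))
    rw [Real.log_mul (he ω).ne' (div_pos hprp hKp).ne', Real.log_div hprp.ne' hK0] at h1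
    simp only [Z, ← heI]
    linarith
  rw [integral_indicator_const _ hE, smul_eq_mul,
    integral_add hlogI hZI1, integral_sub hZI (integrable_const 1),
    ← directedInfo_mul_log_two hq hq' hW hp] at hmain
  simp only [integral_const, probReal_univ, smul_eq_mul, mul_one] at hmain
  linarith

end DirectedInfo

/-! ### Closed loops over Class A channels -/

section ClosedLoop

variable {Ω A A' : Type*} [MeasurableSpace Ω]
    [Fintype A] [MeasurableSpace A] [MeasurableSingletonClass A]
    [Fintype A'] [MeasurableSpace A'] [MeasurableSingletonClass A']
    {P : Measure Ω} [IsProbabilityMeasure P] {N m : ℕ} {f : Vec N → Vec N}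
    {B : Vec m →ₗ[ℝ] Vec N} {ν : Measure (Vec N)} {W : Channel A A'}
    {γe : (t : ℕ) → (Fin (t + 1) → Vec N) → (Fin t → A') → A}
    {γc : (t : ℕ) → (Fin (t + 1) → A') → Vec m} {x w : ℕ → Ω → Vec N} {u : ℕ → Ω → Vec m}
    {q : ℕ → Ω → A} {q' : ℕ → Ω → A'} {C : ℝ}

namespace IsClosedLoop

theorem measurable_state (h : IsClosedLoop P f B ν W γe γc x w u q q') (hf : Measurable f)
    (t : ℕ) : Measurable (x t) := by
  induction t with
  | zero => exact h.measurable_init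
  | succ t ih =>
    have hu : Measurable fun ω => B (u t ω) := by
      have : (fun ω => B (u t ω)) = fun ω => B (γc t (hist q' (t + 1) ω)) :=
        funext fun ω => by rw [h.control_eq]
      rw [this]
      exact (Measurable.of_discrete (f := fun s => B (γc t s))).comp
        (measurable_hist fun i _ => h.measurable_output i)
    rw [show x (t + 1) = _ from funext (h.state_eq t)]
    exact ((hf.comp ih).add hu).add (h.measurable_noise t)

theorem measurable_input (h : IsClosedLoop P f B ν W γe γc x w u q q') (hf : Measurable f)
    (t : ℕ) : Measurable (q t) := by
  rw [show q t = _ from funext (h.encoder_eq t)]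
  exact (h.measurable_encoder t).comp ((measurable_hist fun i _ => h.measurable_state hf i).prodMk
    (measurable_hist fun i _ => h.measurable_output i))

/-- Along an output string the closed-loop state follows the open-loop trajectory. -/
theorem state_eq_openLoopState (h : IsClosedLoop P f B ν W γe γc x w u q q') {s : ℕ → A'} {ω : Ω}
    {t : ℕ} (hs : ∀ i < t, q' i ω = s i) :
    x t ω = openLoopState f B γc s t (x 0 ω, fun i => w i ω) := by
  induction t with
  | zero => rfl
  | succ t ih =>
    have hh : hist q' (t + 1) ω = fun i : Fin (t + 1) => s i :=
      funext fun i => hs i i.isLt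
    rw [h.state_eq, h.control_eq, hh, ih fun i hi => hs i (by omega), openLoopState]

/-- The converse bound for a closed loop over a Class A channel. -/
theorem measureReal_mul_log_le (h : IsClosedLoop P f B ν W γe γc x w u q q') (hf : Measurable f)
    (hA : IsClassA P W (x 0) w q q' C) {T : ℕ} (hT : 0 < T)
    {D : (Fin T → A') → Set (Vec N × (ℕ → Vec N))} (hD : ∀ s, MeasurableSet (D s)) {ε : ℝ}
    (hε : 0 < ε) (hDε : ∀ s, P {ω | (x 0 ω, fun i => w i ω) ∈ D s} ≤ ENNReal.ofReal ε) :
    P.real {ω | (x 0 ω, fun i => w i ω) ∈ D (hist q' T ω)} * Real.log ε⁻¹ ≤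
      T * maxDirectedInfoRate W T * Real.log 2 + 1 := by
  have hq := h.measurable_input hf
  have hw : Measurable fun ω i => w i ω := measurable_pi_lambda _ h.measurable_noise
  obtain ⟨π, hπ⟩ := exists_inputKernels hq h.measurable_output h.channel_law
  have h1 := measureReal_mul_log_le_directedInfo hq h.measurable_output
    (h.measurable_init.prodMk hw) h.channel_law (hπ T)
    (fun s g hg => setLIntegral_div_likelihood_le hq h.measurable_output
      (sup_le h.measurable_init.comap_le hw.comap_le)
      (Measurable.prodMk ((comap_measurable _).mono le_sup_left le_rfl)
        ((comap_measurable _).mono le_sup_right le_rfl))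
      -- The Class A property: knowing the source as well does not change the transition law.
      (fun t b => (hA.markov t {b}).trans (h.channel_law t b)) T s hg) hD hε hDε
  have h2 : (1 / (T : ℝ)) * directedInfo (jointLaw W π T) ≤ maxDirectedInfoRate W T :=
    le_ciSup (bddAbove_directedInfoRate W T) π
  have hT' : (0 : ℝ) < T := by exact_mod_cast hT
  have h3 : directedInfo (jointLaw W π T) ≤ T * maxDirectedInfoRate W T := by
    rwa [one_div, inv_mul_le_iff₀ hT'] at h2
  have := mul_le_mul_of_nonneg_right h3 (Real.log_nonneg one_le_two)
  linarith

/-- The converse bound for the empty event with ε = 1 reads 0 ≤ T · rate · log 2 + 1; dividing by T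
and passing to the limit removes the constant. Together with `C < L` this gives `0 < L`. -/
theorem capacity_nonneg (h : IsClosedLoop P f B ν W γe γc x w u q q') (hf : Measurable f)
    (hA : IsClassA P W (x 0) w q q' C) : 0 ≤ C := by
  have hlim : Tendsto (fun T : ℕ => maxDirectedInfoRate W T * Real.log 2 + 1 / (T : ℝ)) atTop
      (𝓝 (C * Real.log 2 + 0)) :=
    (hA.capacity.mul_const _).add tendsto_one_div_atTop_nhds_zero_nat
  have h0 : 0 ≤ C * Real.log 2 + 0 := by
    refine ge_of_tendsto hlim ?_
    filter_upwards [eventually_gt_atTop 0] with T hT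
    have h1 := h.measureReal_mul_log_le hf hA hT (D := fun _ => ∅) (fun _ => MeasurableSet.empty)
      one_pos (fun _ => by simp)
    have hT' : (0 : ℝ) < T := by exact_mod_cast hT
    rw [inv_one, Real.log_one, mul_zero] at h1
    have : maxDirectedInfoRate W T * Real.log 2 + 1 / (T : ℝ) =
        (T * maxDirectedInfoRate W T * Real.log 2 + 1) / T := by field_simp
    rw [this]
    positivity
  rw [add_zero] at h0
  exact nonneg_of_mul_nonneg_left h0 (Real.log_pos one_lt_two)

/-- Finite-horizon bound for the probability of starting in a set with bounded density and ending
in a ball. -/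
theorem measureReal_inter_mul_log_le (h : IsClosedLoop P f B ν W γe γc x w u q q')
    (hf : ContDiff ℝ 1 f) (hinj : Function.Injective f) (hA : IsClassA P W (x 0) w q q' C)
    {c : ℝ} (hc0 : 0 < c) (hc : ∀ y, c ≤ |(fderiv ℝ f y).det|) {G : Set (Vec N)}
    (hG : MeasurableSet G) {K : ℕ} (hK0 : 0 < K)
    (hK : ∀ D, MeasurableSet D → P.map (x 0) (G ∩ D) ≤ K * volume D) {T : ℕ} (hT : 0 < T) {r : ℝ}
    (hr : 0 < r) :
    P.real {ω | x 0 ω ∈ G ∧ ‖x T ω‖ ≤ r} *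
      (T * Real.log c - N * Real.log r -
        Real.log (K * volume.real (Metric.ball (0 : Vec N) 1))) ≤
      T * maxDirectedInfoRate W T * Real.log 2 + 1 := by
  have hfm : Measurable f := hf.continuous.measurable
  obtain ⟨ω₀⟩ := P.nonempty_of_neZero
  -- The padding is immaterial: the state at time `T` depends only on the outputs before `T`.
  set ext : (Fin T → A') → ℕ → A' := fun s i => if hi : i < T then s ⟨i, hi⟩ else q' 0 ω₀
  set v := volume.real (Metric.ball (0 : Vec N) 1) with hv
  have hvt : volume (Metric.ball (0 : Vec N) 1) ≠ ⊤ := measure_ball_lt_top.ne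
  have hv0 : 0 < v :=
    ENNReal.toReal_pos (Metric.measure_ball_pos volume _ one_pos).ne' hvt
  have hKr : (0 : ℝ) < K := by exact_mod_cast hK0
  -- Density bound times the volume of the ball of radius `r`, contracted by `c ^ T`.
  set ε : ℝ := K * (r ^ N * v / c ^ T) with hεdef
  have hε : 0 < ε := by positivity
  have h1 := h.measureReal_mul_log_le hfm hA hT
    (D := fun s => {S | S.1 ∈ G ∧ ‖openLoopState f B γc (ext s) T S‖ ≤ r})
    (fun s => (measurable_fst hG).inter
      (measurableSet_le (measurable_openLoopState hfm T).norm measurable_const)) hε (fun s => by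
        refine (measure_openLoopState_le h.measurable_init h.measurable_noise h.init_indep hf hinj
          (c := ENNReal.ofReal c) (by simpa using hc0) ENNReal.ofReal_ne_top
          (fun y => ENNReal.ofReal_le_ofReal (hc y)) hG hK T r).trans (le_of_eq ?_)
        rw [Measure.addHaar_closedBall _ _ hr.le, finrank_euclideanSpace_fin, hεdef,
          ENNReal.ofReal_mul hKr.le, ENNReal.ofReal_natCast,
          ENNReal.ofReal_div_of_pos (by positivity), ENNReal.ofReal_mul (by positivity),
          ENNReal.ofReal_pow hc0.le, hv, ofReal_measureReal hvt])
  have hset : {ω | (x 0 ω, fun i => w i ω) ∈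
      {S : Vec N × (ℕ → Vec N) | S.1 ∈ G ∧ ‖openLoopState f B γc (ext (hist q' T ω)) T S‖ ≤ r}} =
      {ω | x 0 ω ∈ G ∧ ‖x T ω‖ ≤ r} := by
    ext ω
    have := h.state_eq_openLoopState (s := ext (hist q' T ω)) (ω := ω) (t := T)
      fun i hi => by simp [ext, hi, hist]
    simp only [Set.mem_ofPred_eq, this]
  rw [hset] at h1
  have hlog : Real.log ε⁻¹ = T * Real.log c - N * Real.log r - Real.log (K * v) := by
    have hrN : (r ^ N) ≠ 0 := (pow_pos hr N).ne'
    have hcT : (c ^ T) ≠ 0 := (pow_pos hc0 T).ne'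
    rw [Real.log_inv, show ε = K * v * r ^ N / c ^ T by rw [hεdef]; ring,
      Real.log_div (by positivity) hcT, Real.log_mul (by positivity) hrN, Real.log_pow,
      Real.log_pow]
    ring
  rwa [hlog] at h1

/-- Subexponential balls capture the state with asymptotic probability at most `C / L`. -/
theorem limsup_measureReal_le (h : IsClosedLoop P f B ν W γe γc x w u q q')
    (hf : ContDiff ℝ 1 f) (hinj : Function.Injective f) (hA : IsClassA P W (x 0) w q q' C)
    {L : ℝ} (hL : 0 < L) (hc : ∀ y, (2 : ℝ) ^ L ≤ |(fderiv ℝ f y).det|)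
    (hac : P.map (x 0) ≪ volume) {b : ℕ → ℝ} (hb_pos : ∀ T, 0 < b T)
    (hb : Tendsto (fun T : ℕ => (1 / (T : ℝ)) * Real.logb 2 (b T)) atTop (𝓝 0)) :
    limsup (fun T : ℕ => P.real {ω | ‖x T ω‖ ≤ b T}) atTop ≤ C / L := by
  have hlog2 := Real.log_pos one_lt_two
  have : IsProbabilityMeasure (P.map (x 0)) :=
    Measure.isProbabilityMeasure_map h.measurable_init.aemeasurable
  refine le_of_forall_pos_le_add fun η hη => ?_
  obtain ⟨K, hK0, G, hG, hGη, hK⟩ := exists_bounded_density (P.map (x 0)) hac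
    (η := ENNReal.ofReal η) (by simpa using hη)
  set κ := Real.log (K * volume.real (Metric.ball (0 : Vec N) 1))
  -- `a T` and `ρ T` are the two sides of the finite-horizon bound divided by `T`, the probability
  -- factor left out. Subexponential growth of `b` removes the radius term in the limit.
  set a : ℕ → ℝ := fun T =>
    Real.log 2 * L - N * (Real.log 2 * ((1 / (T : ℝ)) * Real.logb 2 (b T))) - κ * (1 / (T : ℝ))
  set ρ : ℕ → ℝ := fun T => maxDirectedInfoRate W T * Real.log 2 + 1 / (T : ℝ)
  have ha : Tendsto a atTop (𝓝 (Real.log 2 * L)) := by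
    have := (tendsto_const_nhds (x := Real.log 2 * L)).sub
      ((hb.const_mul (Real.log 2)).const_mul (N : ℝ)) |>.sub
      ((tendsto_one_div_atTop_nhds_zero_nat (𝕜 := ℝ)).const_mul κ)
    simpa [a] using this
  have hρ : Tendsto ρ atTop (𝓝 (C * Real.log 2)) := by
    simpa [ρ] using (hA.capacity.mul_const (Real.log 2)).add
      (tendsto_one_div_atTop_nhds_zero_nat (𝕜 := ℝ))
  have hL0 : 0 < Real.log 2 * L := mul_pos hlog2 hL
  have hlim : Tendsto (fun T => ρ T / a T + η) atTop (𝓝 (C / L + η)) := by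
    have h1 := (hρ.div ha hL0.ne').add_const η
    rwa [mul_comm C, mul_div_mul_left _ _ hlog2.ne'] at h1
  have hle : ∀ᶠ T in atTop, P.real {ω | ‖x T ω‖ ≤ b T} ≤ ρ T / a T + η := by
    filter_upwards [ha.eventually (lt_mem_nhds hL0), eventually_gt_atTop 0] with T haT hT
    have hT' : (0 : ℝ) < T := by exact_mod_cast hT
    have h1 := h.measureReal_inter_mul_log_le hf hinj hA (Real.rpow_pos_of_pos two_pos L) hc hG
      hK0 hK hT (hb_pos T)
    have h2 : P.real {ω | x 0 ω ∈ G ∧ ‖x T ω‖ ≤ b T} ≤ ρ T / a T := by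
      rw [le_div_iff₀ haT]
      have e1 : T * Real.log ((2 : ℝ) ^ L) - N * Real.log (b T) - κ = T * a T := by
        simp only [a, Real.logb]
        rw [Real.log_rpow two_pos]
        field_simp
      have e2 : T * maxDirectedInfoRate W T * Real.log 2 + 1 = T * ρ T := by
        simp only [ρ]; field_simp
      rw [e1, e2, mul_left_comm] at h1
      exact le_of_mul_le_mul_left h1 hT'
    have h3 : P.real {ω | x 0 ω ∈ Gᶜ} ≤ η := by
      refine ENNReal.toReal_le_of_le_ofReal hη.le ?_
      rwa [Measure.map_apply h.measurable_init hG.compl] at hGη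
    calc P.real {ω | ‖x T ω‖ ≤ b T}
        ≤ P.real ({ω | x 0 ω ∈ G ∧ ‖x T ω‖ ≤ b T} ∪ {ω | x 0 ω ∈ Gᶜ}) :=
          measureReal_mono fun ω hω => by
            by_cases hωG : x 0 ω ∈ G
            · exact Or.inl ⟨hωG, hω⟩
            · exact Or.inr hωG
      _ ≤ _ := measureReal_union_le _ _
      _ ≤ ρ T / a T + η := add_le_add h2 h3
  calc limsup (fun T : ℕ => P.real {ω | ‖x T ω‖ ≤ b T}) atTop
      ≤ limsup (fun T => ρ T / a T + η) atTop :=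
        limsup_le_limsup hle
          (isCoboundedUnder_le_of_le atTop (x := 0) fun _ => measureReal_nonneg)
          hlim.isBoundedUnder_le
    _ = C / L + η := hlim.limsup_eq

end IsClosedLoop

end ClosedLoop

theorem LogJacBounds.two_rpow_le {N : ℕ} {f : Vec N → Vec N} {L M : ℝ} (h : LogJacBounds f L M)
    (y : Vec N) : (2 : ℝ) ^ L ≤ |(fderiv ℝ f y).det| := by
  have h0 : 0 < |(fderiv ℝ f y).det| := abs_pos.2 (h.det_ne_zero y)
  exact (Real.le_logb_iff_rpow_le one_lt_two h0).1 (h.isGLB.1 ⟨y, rfl⟩)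

theorem LogJacBounds.le {N : ℕ} {f : Vec N → Vec N} {L M : ℝ} (h : LogJacBounds f L M) : L ≤ M :=
  (h.isGLB.1 ⟨0, rfl⟩).trans (h.isLUB.1 ⟨0, rfl⟩)

end NetCtrl
end

theorem mainTheorem5 {Ω A A' : Type*} [MeasurableSpace Ω]
    [Fintype A] [MeasurableSpace A] [MeasurableSingletonClass A]
    [Fintype A'] [MeasurableSpace A'] [MeasurableSingletonClass A']
    (P : Measure Ω) [IsProbabilityMeasure P] {N m : ℕ}
    (f : NetCtrl.Vec N → NetCtrl.Vec N) (B : NetCtrl.Vec m →ₗ[ℝ] NetCtrl.Vec N)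
    (ν : Measure (NetCtrl.Vec N)) (W : NetCtrl.Channel A A')
    (γe : (t : ℕ) → (Fin (t + 1) → NetCtrl.Vec N) → (Fin t → A') → A)
    (γc : (t : ℕ) → (Fin (t + 1) → A') → NetCtrl.Vec m)
    (x w : ℕ → Ω → NetCtrl.Vec N) (u : ℕ → Ω → NetCtrl.Vec m)
    (q : ℕ → Ω → A) (q' : ℕ → Ω → A') (C L M : ℝ)
    (hf : ContDiff ℝ 1 f) (hf_inv : Function.Bijective f)
    (hbounds : NetCtrl.LogJacBounds f L M)
    (hloop : NetCtrl.IsClosedLoop P f B ν W γe γc x w u q q')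
    (hclassA : NetCtrl.IsClassA P W (x 0) w q q' C)
    (hx_ac : P.map (x 0) ≪ volume)
    (hx_entropy : NetCtrl.diffEntropy (P.map (x 0)) < ⊤)
    (hCL : C < L)
    (b : ℕ → ℝ) (hb_pos : ∀ T, 0 < b T)
    (hb : Tendsto (fun T : ℕ => (1 / (T : ℝ)) * Real.logb 2 (b T)) atTop (𝓝 0)) :
    limsup (fun T : ℕ => P.real {ω | ‖x T ω‖ ≤ b T}) atTop ≤ 1 - (L - C) / M := by
  have hfm : Measurable f := hf.continuous.measurable
  have hL : 0 < L := (hloop.capacity_nonneg hfm hclassA).trans_lt hCL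
  refine (hloop.limsup_measureReal_le hf hf_inv.injective hclassA hL hbounds.two_rpow_le hx_ac
    hb_pos hb).trans ?_
  -- The bound C / L already obtained is at least as strong as the claim, as `0 < L ≤ M` and `L - C`
  -- is positive.
  have h1 : (L - C) / M ≤ (L - C) / L :=
    div_le_div_of_nonneg_left (sub_pos.2 hCL).le hL hbounds.le
  have h2 : (L - C) / L = 1 - C / L := by rw [sub_div, div_self hL.ne']
  linarith
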